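/- Let $p>5$ be a prime. Let $L_n$ denote the Lucas numbers, $L_0=2$, $L_1=1$, $L_n=L_{n-1}+L_{n-2}$ for $n>1$; let $\varphi=\frac{1+\sqrt5}{2}$ be the golden ratio, $\mathcal L_1(x)=\sum_{k=1}^{p-1}\frac{x^k}{k}$ the finite $1$-logarithm, $H_{p-1}(1)=\sum_{k=1}^{p-1}\frac1k$, and let $B_n$ be the Bernoulli numbers, defined by $\frac{t}{e^t-1}=\sum_{n\ge0}B_n\frac{t^n}{n!}$. Then $$ p\sum_{k=1}^{p-1}\frac{(-1)^{k-1}}{k^5\binom{2k}{k}}\equiv \frac{5(1-L_p^2)}{8p^4}-\frac{5}{4p^3}\bigl(\mathcal L_1(\varphi^2)+\mathcal L_1(\varphi^{-2})\bigr)+\frac{3H_{p-1}(1)}{p^3}-\frac{3p}{5}B_{p-5} \pmod{p^2} $$ and $$ \sum_{k=1}^{p-1}\frac{(-1)^{k}\binom{2k}{k}}{k^4}\equiv \frac{5(1-L_p^2)}{4p^4}-\frac{5}{2p^3}\bigl(\mathcal L_1(\varphi^2)+\mathcal L_1(\varphi^{-2})\bigr)+\frac{6H_{p-1}(1)}{p^3}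 \pmod{p}. $$ Both sides of each congruence are rational numbers, and $x\equiv y\pmod{p^m}$ means that $x-y=p^m r$ for a rational number $r$ whose reduced denominator is not divisible by $p$. -/

import Mathlib

/-- The Lucas numbers: `L 0 = 2`, `L 1 = 1`, `L n = L (n - 1) + L (n - 2)` for `n > 1`. -/
def lucasNumber : ℕ → ℤ
  | 0 => 2
  | 1 => 1
  | n + 2 => lucasNumber (n + 1) + lucasNumber n

/-- The finite `1`-logarithm `∑_{k=1}^{p-1} x ^ k / k`. -/
noncomputable def finiteLog (p : ℕ) (x : ℝ) : ℝ :=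
  ∑ k ∈ Finset.Icc 1 (p - 1), x ^ k / (k : ℝ)

/-- The congruence `x ≡ y (mod p ^ m)` in the sense of `p`-integral rationals: the difference
`x - y` is a rational number of the form `p ^ m * r`, where `r` is a rational number whose reduced
denominator is not divisible by `p`. It is stated for real `x` and `y`, since
expressions in the golden ratio occur in them. -/
def CongrModPrimePow (p m : ℕ) (x y : ℝ) : Prop :=
  ∃ r : ℚ, ¬ p ∣ r.den ∧ x - y = (p : ℝ) ^ m * (r : ℝ)

/-! ### Rational numbers divisible by a power of `p` -/

/-! The finite Koecher-Leshchiner identity `sum_one_div_mul_sq_sub_eq` at `s = p ^ 2`, `N = p - 1`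
becomes the exact relation V = (5/2) T + 2 p² U - H/p² (`sum_one_div_mul_sq_sub_sq_eq`). Here V = ∑
1/(n(n² - p²)), H = H_{p-1}(1), T and U have summands containing ∏_{j≤m}(p² - j²)/(2m+2)!, and those
of U carry the extra factor 1/((m+1)² - p²).

Each sum is evaluated separately. The summands of 2p²T are coefficients of x^p + x^(-p) in powers of
x + x⁻¹ - 2, divided by the exponent; at x = φ² that variable equals 1, so T is exactly a
combination of L_p², the finite logarithms and H (`two_mul_sq_mul_sum_prodSubSq`). Pairing k with p
- k and a power-sum congruence give 5V ≡ -6p²B_{p-5} mod p³ (`sum_inv_mul_sq_sub_sq_mem`). Termwise,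
pU agrees mod p² with the first sum of the theorem (`prime_mul_sum_prodSubSq_sub_mem`). Solving for
pU gives the first congruence. The second follows by k ↦ p - k, which inverts central binomial
coefficients mod p (`prime_div_centralBinom_sub_mem`). -/

/-- The rational numbers `p ^ m * r` with `r` a `p`-integral rational number. -/
def primePowMultiples (p m : ℕ) [Fact p.Prime] : AddSubgroup ℚ where
  carrier := {x | ∃ r : ℚ, ¬ p ∣ r.den ∧ x = (p : ℚ) ^ m * r}
  zero_mem' := ⟨0, by simpa using (Fact.out : p.Prime).one_lt.ne', by simp⟩
  add_mem' := by
    rintro _ _ ⟨r, hr, rfl⟩ ⟨s, hs, rfl⟩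
    refine ⟨r + s, fun h => ?_, by ring⟩
    rcases (Fact.out : p.Prime).dvd_mul.1 (h.trans (Rat.add_den_dvd r s)) with h | h
    exacts [hr h, hs h]
  neg_mem' := by
    rintro _ ⟨r, hr, rfl⟩
    exact ⟨-r, by simpa using hr, by ring⟩

namespace primePowMultiples

variable {p : ℕ} [Fact p.Prime] {m n : ℕ} {x y : ℚ}

theorem mem_iff : x ∈ primePowMultiples p m ↔ ∃ r : ℚ, ¬ p ∣ r.den ∧ x = (p : ℚ) ^ m * r :=
  Iff.rfl

theorem prime_ne_zero : (p : ℚ) ≠ 0 := Nat.cast_ne_zero.2 (Fact.out : p.Prime).ne_zero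

theorem mem_zero_iff : x ∈ primePowMultiples p 0 ↔ ¬ p ∣ x.den := by
  simp [mem_iff]

theorem intCast_mem (z : ℤ) : (z : ℚ) ∈ primePowMultiples p 0 := by
  rw [mem_zero_iff]
  simpa using (Fact.out : p.Prime).one_lt.ne'

theorem natCast_mem (k : ℕ) : (k : ℚ) ∈ primePowMultiples p 0 := by
  exact_mod_cast intCast_mem (p := p) (k : ℤ)

theorem one_mem : (1 : ℚ) ∈ primePowMultiples p 0 := by
  exact_mod_cast natCast_mem (p := p) 1

theorem mul_mem (hx : x ∈ primePowMultiples p m) (hy : y ∈ primePowMultiples p n) :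
    x * y ∈ primePowMultiples p (m + n) := by
  obtain ⟨r, hr, rfl⟩ := hx
  obtain ⟨s, hs, rfl⟩ := hy
  refine ⟨r * s, fun h => ?_, by ring⟩
  rcases (Fact.out : p.Prime).dvd_mul.1 (h.trans (Rat.mul_den_dvd r s)) with h | h
  exacts [hr h, hs h]

theorem zero_mul_mem (hx : x ∈ primePowMultiples p 0) (hy : y ∈ primePowMultiples p n) :
    x * y ∈ primePowMultiples p n := by
  simpa using mul_mem hx hy

theorem mul_zero_mem (hx : x ∈ primePowMultiples p m) (hy : y ∈ primePowMultiples p 0) :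
    x * y ∈ primePowMultiples p m := mul_mem hx hy

theorem pow_mem (hx : x ∈ primePowMultiples p 0) (k : ℕ) : x ^ k ∈ primePowMultiples p 0 := by
  induction k with
  | zero => simpa using one_mem
  | succ k ih => rw [pow_succ]; exact mul_zero_mem ih hx

theorem prime_pow_mem (m : ℕ) : (p : ℚ) ^ m ∈ primePowMultiples p m :=
  ⟨1, by simpa using (Fact.out : p.Prime).one_lt.ne', by simp⟩

theorem prime_mem : (p : ℚ) ∈ primePowMultiples p 1 := by
  simpa using prime_pow_mem (p := p) 1

theorem anti (h : n ≤ m) (hx : x ∈ primePowMultiples p m) : x ∈ primePowMultiples p n := by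
  obtain ⟨r, hr, rfl⟩ := hx
  obtain ⟨d, rfl⟩ := Nat.exists_eq_add_of_le h
  rw [pow_add, mul_assoc]
  refine mul_zero_mem (prime_pow_mem n) (zero_mul_mem ?_ (mem_zero_iff.2 hr))
  exact_mod_cast natCast_mem (p := p) (p ^ d)

theorem of_prime_pow_mul_mem (hx : (p : ℚ) ^ n * x ∈ primePowMultiples p (n + m)) :
    x ∈ primePowMultiples p m := by
  obtain ⟨r, hr, h⟩ := hx
  refine ⟨r, hr, mul_left_cancel₀ (pow_ne_zero n (prime_ne_zero (p := p))) ?_⟩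
  rw [h]; ring

theorem intCast_mem_one {z : ℤ} (hz : (p : ℤ) ∣ z) : (z : ℚ) ∈ primePowMultiples p 1 := by
  obtain ⟨w, rfl⟩ := hz
  push_cast
  exact mul_zero_mem prime_mem (intCast_mem w)

theorem inv_intCast_mem {z : ℤ} (hz : ¬ (p : ℤ) ∣ z) : (z : ℚ)⁻¹ ∈ primePowMultiples p 0 := by
  rw [mem_zero_iff, Rat.inv_intCast_den]
  split_ifs with h
  · simpa using (Fact.out : p.Prime).one_lt.ne'
  · rwa [← Int.natCast_dvd]

theorem inv_natCast_mem {k : ℕ} (hk : ¬ p ∣ k) : (k : ℚ)⁻¹ ∈ primePowMultiples p 0 := by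
  have := inv_intCast_mem (p := p) (z := (k : ℤ)) (by exact_mod_cast hk)
  exact_mod_cast this

theorem sum_sub_sum_mem {ι : Type*} {s : Finset ι} {f g : ι → ℚ}
    (h : ∀ i ∈ s, f i - g i ∈ primePowMultiples p m) :
    ∑ i ∈ s, f i - ∑ i ∈ s, g i ∈ primePowMultiples p m := by
  rw [← Finset.sum_sub_distrib]
  exact sum_mem h

theorem congrModPrimePow_of_sub_mem (h : x - y ∈ primePowMultiples p m) :
    CongrModPrimePow p m (x : ℝ) (y : ℝ) := by
  obtain ⟨r, hr, h⟩ := h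
  exact ⟨r, hr, by exact_mod_cast h⟩

end primePowMultiples

/-! ### Two families of finite identities -/

/-- The product `∏_{j=1}^{m} (s - j ^ 2)`. -/
def prodSubSq (s : ℚ) (m : ℕ) : ℚ := ∏ j ∈ Finset.range m, (s - ((j : ℚ) + 1) ^ 2)

theorem prodSubSq_succ (s : ℚ) (m : ℕ) :
    prodSubSq s (m + 1) = prodSubSq s m * (s - ((m : ℚ) + 1) ^ 2) :=
  Finset.prod_range_succ _ _

/-- Each factor is (n - j)(n + j), so the product runs over the integers from n - m to n + m with n
left out. -/
theorem prodSubSq_sq_mul_factorial (n m : ℕ) (h : m + 1 ≤ n) :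
    prodSubSq ((n : ℚ) ^ 2) m * (n * (n - m - 1).factorial) = (n + m).factorial := by
  induction m with
  | zero =>
    obtain ⟨d, rfl⟩ := Nat.exists_eq_add_of_le' h
    simp [prodSubSq, Nat.factorial_succ]
  | succ m ih =>
    obtain ⟨d, rfl⟩ := Nat.exists_eq_add_of_le' h
    have ih := ih (by omega)
    rw [show d + (m + 1 + 1) - m - 1 = d + 1 by omega] at ih
    rw [show d + (m + 1 + 1) - (m + 1) - 1 = d by omega, prodSubSq_succ,
      show d + (m + 1 + 1) + (m + 1) = (d + (m + 1 + 1) + m) + 1 by omega,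
      Nat.factorial_succ, Nat.cast_mul, ← ih, Nat.factorial_succ]
    push_cast
    ring

/-- Telescoping: n² - s = (n - K - 1)(n + K + 1) - (s - (K + 1)²) makes the summand the difference
of consecutive boundary terms. -/
theorem sum_prodSubSq_mul_factorial_div (s : ℚ) (n K : ℕ) (hK : K + 1 ≤ n)
    (hs : (n : ℚ) ^ 2 - s ≠ 0) :
    ∑ m ∈ Finset.range K, prodSubSq s m * (n - m - 2).factorial / (n + m + 1).factorial =
      1 / (n * ((n : ℚ) ^ 2 - s)) -
        prodSubSq s K * (n - K - 1).factorial / ((n + K).factorial * ((n : ℚ) ^ 2 - s)) := by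
  induction K with
  | zero =>
    obtain ⟨d, rfl⟩ := Nat.exists_eq_add_of_le' hK
    have h1 : ((d : ℚ) + 1) ≠ 0 := by positivity
    have h2 : (d.factorial : ℚ) ≠ 0 := by positivity
    simp only [prodSubSq, zero_add, Finset.range_zero, Finset.sum_empty, Finset.prod_empty,
      Nat.sub_zero, Nat.add_sub_cancel, add_zero, Nat.factorial_succ] at hs ⊢
    push_cast at hs ⊢
    field_simp
    ring
  | succ K ih =>
    rw [Finset.sum_range_succ, ih (by omega)]
    obtain ⟨d, rfl⟩ := Nat.exists_eq_add_of_le' hK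
    rw [show d + (K + 1 + 1) - K - 1 = d + 1 by omega, show d + (K + 1 + 1) - K - 2 = d by omega,
      show d + (K + 1 + 1) - (K + 1) - 1 = d by omega, prodSubSq_succ,
      show d + (K + 1 + 1) + (K + 1) = (d + (K + 1 + 1) + K) + 1 by omega,
      Nat.factorial_succ, Nat.factorial_succ]
    have h1 : (((d + (K + 1 + 1) + K).factorial : ℕ) : ℚ) ≠ 0 := by positivity
    have h2 : (d : ℚ) + (K + 1 + 1) + K + 1 ≠ 0 := by positivity
    push_cast at hs ⊢
    field_simp
    ring

theorem one_div_mul_sq_sub_eq (s : ℚ) (n : ℕ) (hs : ((n : ℚ) + 1) ^ 2 - s ≠ 0) :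
    1 / (((n : ℚ) + 1) * (((n : ℚ) + 1) ^ 2 - s)) =
      ∑ m ∈ Finset.range n, prodSubSq s m * (n - m - 1).factorial / (n + m + 2).factorial +
        prodSubSq s n / ((2 * n + 1).factorial * (((n : ℚ) + 1) ^ 2 - s)) := by
  have h := sum_prodSubSq_mul_factorial_div s (n + 1) n le_rfl (by exact_mod_cast hs)
  have e : ∑ m ∈ Finset.range n, prodSubSq s m * (n - m - 1).factorial / (n + m + 2).factorial =
      ∑ m ∈ Finset.range n,
        prodSubSq s m * (n + 1 - m - 2).factorial / (n + 1 + m + 1).factorial :=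
    Finset.sum_congr rfl fun m _ => by
      rw [show n + 1 - m - 2 = n - m - 1 by omega, show n + 1 + m + 1 = n + m + 2 by omega]
  rw [e, h, show n + 1 - n - 1 = 0 by omega, show n + 1 + n = 2 * n + 1 by omega]
  push_cast
  simp

/-- A finite form of the Koecher-Leshchiner identity. -/
theorem sum_one_div_mul_sq_sub_eq (s : ℚ) (N : ℕ)
    (hs : ∀ n < N, ((n : ℚ) + 1) ^ 2 - s ≠ 0) :
    ∑ n ∈ Finset.range N, 1 / (((n : ℚ) + 1) * (((n : ℚ) + 1) ^ 2 - s)) =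
      ∑ m ∈ Finset.range N, prodSubSq s m * (5 * ((m : ℚ) + 1) ^ 2 - s) /
          (2 * ((m : ℚ) + 1) * (2 * m + 2).factorial * (((m : ℚ) + 1) ^ 2 - s)) -
        ∑ m ∈ Finset.range N, prodSubSq s m * (N - m - 1).factorial /
          (2 * ((m : ℚ) + 1) * (N + m + 1).factorial) := by
  induction N with
  | zero => simp
  | succ N ih =>
    have hN := hs N (Nat.lt_succ_self N)
    rw [Finset.sum_range_succ, ih fun n hn => hs n (hn.trans (Nat.lt_succ_self N)),
      one_div_mul_sq_sub_eq s N hN, Finset.sum_range_succ _ N, Finset.sum_range_succ _ N]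
    -- Since (N + m + 2) - (N - m) = 2(m + 1), passing from N to N + 1 in the tail absorbs the
    -- expansion of the new summand.
    have key : ∑ m ∈ Finset.range N, prodSubSq s m * (N + 1 - m - 1).factorial /
          (2 * ((m : ℚ) + 1) * (N + 1 + m + 1).factorial) =
        ∑ m ∈ Finset.range N, prodSubSq s m * (N - m - 1).factorial /
          (2 * ((m : ℚ) + 1) * (N + m + 1).factorial) -
        ∑ m ∈ Finset.range N, prodSubSq s m * (N - m - 1).factorial / (N + m + 2).factorial := by
      rw [← Finset.sum_sub_distrib]
      refine Finset.sum_congr rfl fun m hm => ?_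
      obtain ⟨d, rfl⟩ := Nat.exists_eq_add_of_lt (Finset.mem_range.1 hm)
      rw [show m + d + 1 + 1 - m - 1 = d + 1 by omega, show m + d + 1 - m - 1 = d by omega,
        show m + d + 1 + 1 + m + 1 = (m + d + 1 + m + 1) + 1 by omega,
        show m + d + 1 + m + 2 = (m + d + 1 + m + 1) + 1 by omega,
        Nat.factorial_succ, Nat.factorial_succ (m + d + 1 + m + 1)]
      have h1 : (((m + d + 1 + m + 1).factorial : ℕ) : ℚ) ≠ 0 := by positivity
      have h2 : (m : ℚ) + d + 1 + m + 1 + 1 ≠ 0 := by positivity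
      have h3 : (m : ℚ) + 1 ≠ 0 := by positivity
      push_cast
      field_simp
      ring
    -- With a = N + 1, this is (5a² - s) - (a² - s) = 4a²; it is the source of the coefficient 5.
    have last : prodSubSq s N / ((2 * N + 1).factorial * (((N : ℚ) + 1) ^ 2 - s)) =
        prodSubSq s N * (5 * ((N : ℚ) + 1) ^ 2 - s) /
          (2 * ((N : ℚ) + 1) * (2 * N + 2).factorial * (((N : ℚ) + 1) ^ 2 - s)) -
        prodSubSq s N * (N + 1 - N - 1).factorial /
          (2 * ((N : ℚ) + 1) * (N + 1 + N + 1).factorial) := by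
      rw [show N + 1 - N - 1 = 0 by omega, show N + 1 + N + 1 = 2 * N + 1 + 1 by omega,
        Nat.factorial_succ (2 * N + 1)]
      have h1 : (((2 * N + 1).factorial : ℕ) : ℚ) ≠ 0 := by positivity
      have h3 : (N : ℚ) + 1 ≠ 0 := by positivity
      have h4 : 2 * (N : ℚ) + 1 + 1 ≠ 0 := by positivity
      push_cast
      simp only [Nat.factorial_zero, Nat.cast_one]
      field_simp
      ring
    rw [key, last]
    ring

theorem harmonic_eq_sum_range (N : ℕ) :
    harmonic N = ∑ m ∈ Finset.range N, 1 / ((m : ℚ) + 1) := by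
  simp [harmonic]

/-- With a = m + 1, 5a² - p² = 5(a² - p²) + 4p² splits the main sum. In the tail all factorials
cancel, leaving 1/(2p·a(p - a)), whose partial fractions sum to the harmonic number. -/
theorem sum_one_div_mul_sq_sub_sq_eq (p : ℕ) (hp : 0 < p) :
    ∑ n ∈ Finset.range (p - 1), 1 / (((n : ℚ) + 1) * (((n : ℚ) + 1) ^ 2 - (p : ℚ) ^ 2)) =
      5 / 2 * ∑ m ∈ Finset.range (p - 1), prodSubSq ((p : ℚ) ^ 2) m /
          (((m : ℚ) + 1) * (2 * m + 2).factorial) +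
        2 * (p : ℚ) ^ 2 * ∑ m ∈ Finset.range (p - 1), prodSubSq ((p : ℚ) ^ 2) m /
          (((m : ℚ) + 1) * (2 * m + 2).factorial * (((m : ℚ) + 1) ^ 2 - (p : ℚ) ^ 2)) -
        harmonic (p - 1) / (p : ℚ) ^ 2 := by
  have hp0 : (p : ℚ) ≠ 0 := by positivity
  have hs : ∀ n < p - 1, ((n : ℚ) + 1) ^ 2 - (p : ℚ) ^ 2 ≠ 0 := by
    intro n hn h
    have : (n + 1) ^ 2 = p ^ 2 := by exact_mod_cast sub_eq_zero.1 h
    have := Nat.pow_left_injective two_ne_zero this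
    omega
  rw [sum_one_div_mul_sq_sub_eq _ _ hs]
  have h1 : ∑ m ∈ Finset.range (p - 1), prodSubSq ((p : ℚ) ^ 2) m * (p - 1 - m - 1).factorial /
          (2 * ((m : ℚ) + 1) * (p - 1 + m + 1).factorial) = harmonic (p - 1) / (p : ℚ) ^ 2 := by
    have h2 : ∀ m ∈ Finset.range (p - 1),
        prodSubSq ((p : ℚ) ^ 2) m * (p - 1 - m - 1).factorial /
          (2 * ((m : ℚ) + 1) * (p - 1 + m + 1).factorial) =
        1 / (2 * (p : ℚ) ^ 2) * (1 / ((m : ℚ) + 1)) +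
          1 / (2 * (p : ℚ) ^ 2) * (1 / (((p - 1 - 1 - m : ℕ) : ℚ) + 1)) := by
      intro m hm
      have hm := Finset.mem_range.1 hm
      obtain ⟨d, rfl⟩ := Nat.exists_eq_add_of_lt (show m + 1 < p by omega)
      have h3 := prodSubSq_sq_mul_factorial (m + 1 + d + 1) m (by omega)
      rw [show m + 1 + d + 1 - m - 1 = d + 1 by omega, Nat.factorial_succ] at h3
      rw [show m + 1 + d + 1 - 1 + m + 1 = m + 1 + d + 1 + m by omega, ← h3,
        show m + 1 + d + 1 - 1 - m - 1 = d by omega,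
        show m + 1 + d + 1 - 1 - 1 - m = d by omega]
      have h4 : prodSubSq (((m + 1 + d + 1 : ℕ) : ℚ) ^ 2) m ≠ 0 := by
        intro h0
        rw [h0, zero_mul] at h3
        exact Nat.cast_ne_zero.2 (Nat.factorial_ne_zero _) h3.symm
      have h5 : (d.factorial : ℚ) ≠ 0 := by positivity
      have h6 : (m : ℚ) + 1 ≠ 0 := by positivity
      have h7 : (d : ℚ) + 1 ≠ 0 := by positivity
      generalize prodSubSq (((m + 1 + d + 1 : ℕ) : ℚ) ^ 2) m = q at *
      push_cast at hp0 ⊢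
      field_simp
      ring
    rw [Finset.sum_congr rfl h2, Finset.sum_add_distrib,
      Finset.sum_range_reflect (fun i => 1 / (2 * (p : ℚ) ^ 2) * (1 / ((i : ℚ) + 1))) (p - 1),
      ← Finset.mul_sum, ← harmonic_eq_sum_range]
    field_simp
    ring
  rw [h1, Finset.mul_sum, Finset.mul_sum, ← Finset.sum_add_distrib]
  congr 1
  refine Finset.sum_congr rfl fun m hm => ?_
  have h2 := hs m (Finset.mem_range.1 hm)
  have h3 : (m : ℚ) + 1 ≠ 0 := by positivity
  field_simp
  ring

/-- The coefficient of `(x + x⁻¹ - 2) ^ k` in `x ^ n + x ^ (-n)`. -/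
def lucasCoeff (n k : ℕ) : ℕ := (n + k).choose (2 * k) + (n + k - 1).choose (2 * k)

theorem lucasCoeff_zero_right (n : ℕ) : lucasCoeff n 0 = 2 := by simp [lucasCoeff]

theorem lucasCoeff_eq_zero {n k : ℕ} (h : n < k) : lucasCoeff n k = 0 := by
  rw [lucasCoeff, Nat.choose_eq_zero_of_lt (by omega), Nat.choose_eq_zero_of_lt (by omega)]

theorem lucasCoeff_self {n : ℕ} (h : 0 < n) : lucasCoeff n n = 1 := by
  rw [lucasCoeff, ← two_mul, Nat.choose_self, Nat.choose_eq_zero_of_lt (by omega)]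

theorem lucasCoeff_succ_sub (n k : ℕ) :
    lucasCoeff (n + 1) (k + 1) =
      lucasCoeff n (k + 1) + ((n + k + 1).choose (2 * k + 1) + (n + k).choose (2 * k + 1)) := by
  simp only [lucasCoeff]
  rw [show n + 1 + (k + 1) - 1 = n + k + 1 by omega, show n + 1 + (k + 1) = n + k + 1 + 1 by omega,
    show n + (k + 1) - 1 = n + k by omega, show n + (k + 1) = n + k + 1 by omega,
    show 2 * (k + 1) = 2 * k + 1 + 1 by omega, Nat.choose_succ_succ (n + k + 1),
    Nat.choose_succ_succ (n + k) (2 * k + 1)]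
  simp only [Nat.succ_eq_add_one]
  ring

/-- This is multiplication of x^(n+1) + x^(-n-1) by x + x⁻¹ = 2 + (x + x⁻¹ - 2). -/
theorem lucasCoeff_second_difference (n k : ℕ) :
    lucasCoeff (n + 2) (k + 1) + lucasCoeff n (k + 1) =
      2 * lucasCoeff (n + 1) (k + 1) + lucasCoeff (n + 1) k := by
  have h1 := lucasCoeff_succ_sub (n + 1) k
  have h2 := lucasCoeff_succ_sub n k
  have h3 : lucasCoeff (n + 1) k = (n + k + 1).choose (2 * k) + (n + k).choose (2 * k) := by
    simp only [lucasCoeff]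
    rw [show n + 1 + k - 1 = n + k by omega, show n + 1 + k = n + k + 1 by omega]
  have h4 := Nat.choose_succ_succ (n + k + 1) (2 * k)
  have h5 := Nat.choose_succ_succ (n + k) (2 * k)
  rw [show n + 1 + 1 = n + 2 from rfl, show n + 1 + k + 1 = n + k + 1 + 1 by omega,
    show n + 1 + k = n + k + 1 by omega] at h1
  simp only [Nat.succ_eq_add_one] at h4 h5
  omega

theorem lucasNumber_add_two (n : ℕ) :
    lucasNumber (n + 2) = lucasNumber (n + 1) + lucasNumber n := rfl

/-- At x = φ² one has x + x⁻¹ - 2 = 1, so the coefficients add up to φ^(2n) + φ^(-2n). -/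
theorem sum_lucasCoeff (n M : ℕ) (h : n < M) :
    ((∑ k ∈ Finset.range M, lucasCoeff n k : ℕ) : ℤ) = lucasNumber (2 * n) := by
  induction n using Nat.twoStepInduction generalizing M with
  | zero =>
    rw [Finset.sum_eq_single_of_mem 0 (Finset.mem_range.2 h) fun k _ hk =>
      lucasCoeff_eq_zero (Nat.pos_of_ne_zero hk), lucasCoeff_zero_right]
    rfl
  | one =>
    rw [← Finset.sum_subset (Finset.range_subset_range.2 h) fun k _ hk =>
      lucasCoeff_eq_zero (by rw [Finset.mem_range] at hk; omega)]
    decide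
  | more n ih1 ih2 =>
    obtain ⟨M, rfl⟩ := Nat.exists_eq_add_of_lt (Nat.zero_lt_of_lt h)
    rw [zero_add] at *
    have e : ∑ k ∈ Finset.range M, lucasCoeff (n + 2) (k + 1) +
        ∑ k ∈ Finset.range M, lucasCoeff n (k + 1) =
        2 * ∑ k ∈ Finset.range M, lucasCoeff (n + 1) (k + 1) +
          ∑ k ∈ Finset.range M, lucasCoeff (n + 1) k := by
      rw [Finset.mul_sum, ← Finset.sum_add_distrib, ← Finset.sum_add_distrib]
      exact Finset.sum_congr rfl fun k _ => lucasCoeff_second_difference n k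
    have h1 := ih1 (M + 1) (by omega)
    have h2 := ih2 (M + 1) (by omega)
    have h3 := ih2 M (by omega)
    rw [Finset.sum_range_succ', lucasCoeff_zero_right] at h1 h2 ⊢
    have r1 : lucasNumber (2 * (n + 2)) = lucasNumber (2 * n + 3) + lucasNumber (2 * (n + 1)) := rfl
    have r2 : lucasNumber (2 * n + 3) = lucasNumber (2 * (n + 1)) + lucasNumber (2 * n + 1) := rfl
    have r3 : lucasNumber (2 * (n + 1)) = lucasNumber (2 * n + 1) + lucasNumber (2 * n) := rfl
    omega

theorem succ_mul_lucasCoeff_succ (n k : ℕ) :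
    (k + 1) * lucasCoeff n (k + 1) = n * (n + k).choose (2 * k + 1) := by
  have h1 := Nat.add_one_mul_choose_eq (n + k) (2 * k + 1)
  have h2 := Nat.choose_succ_right_eq (n + k) (2 * k + 1)
  rcases Nat.lt_or_ge (n + k) (2 * k + 1) with h | h
  · rw [lucasCoeff_eq_zero (by omega), Nat.choose_eq_zero_of_lt h]
    rfl
  · obtain ⟨d, hd⟩ := Nat.exists_eq_add_of_le h
    obtain rfl : n = k + 1 + d := by omega
    rw [lucasCoeff, show k + 1 + d + (k + 1) - 1 = k + 1 + d + k by omega,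
      show k + 1 + d + (k + 1) = k + 1 + d + k + 1 by omega,
      show 2 * (k + 1) = 2 * k + 1 + 1 by omega]
    rw [show k + 1 + d + k - (2 * k + 1) = d by omega] at h2
    nlinarith

/-- By `succ_mul_lucasCoeff_succ` the weight 1/(k + 1) can be traded for weights 1/n and 1/(n + 1)
in the difference from n to n + 1, and the sum over k is then a Lucas number. The term j = 0 is 0/0
= 0. -/
theorem sum_lucasCoeff_succ_div (n M : ℕ) (h : n ≤ M) :
    ∑ k ∈ Finset.range M, (lucasCoeff n (k + 1) : ℚ) / ((k : ℚ) + 1) =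
      ((lucasNumber (2 * n) : ℚ) - 2) / n +
        2 * ∑ j ∈ Finset.range n, ((lucasNumber (2 * j) : ℚ) - 2) / j := by
  have hsum : ∀ n ≤ M, ∑ k ∈ Finset.range M, (lucasCoeff n (k + 1) : ℚ) =
      (lucasNumber (2 * n) : ℚ) - 2 := by
    intro n hn
    have := sum_lucasCoeff n (M + 1) (by omega)
    rw [Finset.sum_range_succ', lucasCoeff_zero_right] at this
    rw [← this]
    push_cast
    ring
  induction n with
  | zero => simp [lucasCoeff_eq_zero]
  | succ n ih =>
    have key : ∀ k, (lucasCoeff (n + 1) (k + 1) : ℚ) / ((k : ℚ) + 1) =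
        (lucasCoeff n (k + 1) : ℚ) / ((k : ℚ) + 1) +
          ((lucasCoeff (n + 1) (k + 1) : ℚ) / ((n : ℚ) + 1) + (lucasCoeff n (k + 1) : ℚ) / n) := by
      intro k
      have h1 : ((k : ℚ) + 1) * lucasCoeff (n + 1) (k + 1) =
          (n + 1) * ((n + k + 1).choose (2 * k + 1) : ℕ) := by
        have := succ_mul_lucasCoeff_succ (n + 1) k
        rw [show n + 1 + k = n + k + 1 by omega] at this
        exact_mod_cast this
      have h2 : ((k : ℚ) + 1) * lucasCoeff n (k + 1) = n * ((n + k).choose (2 * k + 1) : ℕ) := by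
        exact_mod_cast succ_mul_lucasCoeff_succ n k
      have h3 : (lucasCoeff (n + 1) (k + 1) : ℚ) = lucasCoeff n (k + 1) +
          (((n + k + 1).choose (2 * k + 1) : ℕ) + ((n + k).choose (2 * k + 1) : ℕ)) := by
        exact_mod_cast lucasCoeff_succ_sub n k
      have hk : (k : ℚ) + 1 ≠ 0 := by positivity
      have hn : (n : ℚ) + 1 ≠ 0 := by positivity
      have e1 : (lucasCoeff (n + 1) (k + 1) : ℚ) / ((n : ℚ) + 1) =
          ((n + k + 1).choose (2 * k + 1) : ℕ) / ((k : ℚ) + 1) := by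
        rw [div_eq_div_iff hn hk]; linarith
      have e2 : (lucasCoeff n (k + 1) : ℚ) / n =
          ((n + k).choose (2 * k + 1) : ℕ) / ((k : ℚ) + 1) := by
        rcases Nat.eq_zero_or_pos n with rfl | hn0
        · rw [Nat.choose_eq_zero_of_lt (by omega)]; simp
        · rw [div_eq_div_iff (by positivity) hk]; linarith
      rw [e1, e2, h3]
      ring
    rw [Finset.sum_congr rfl fun k _ => key k, Finset.sum_add_distrib, Finset.sum_add_distrib,
      ← Finset.sum_div, ← Finset.sum_div, hsum n (by omega), hsum (n + 1) h, ih (by omega),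
      Finset.sum_range_succ]
    push_cast
    ring

theorem lucasCoeff_succ_eq (n m : ℕ) (h : m + 1 < n) :
    (lucasCoeff n (m + 1) : ℚ) =
      2 * (n : ℚ) ^ 2 * (prodSubSq ((n : ℚ) ^ 2) m / (2 * m + 2).factorial) := by
  have h1 := succ_mul_lucasCoeff_succ n m
  have h2 := Nat.choose_mul_factorial_mul_factorial (show 2 * m + 1 ≤ n + m by omega)
  have h3 := prodSubSq_sq_mul_factorial n m h.le
  rw [← h2, show n + m - (2 * m + 1) = n - m - 1 by omega] at h3
  have h4 : ((n - m - 1).factorial : ℚ) ≠ 0 := by positivity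
  have h5 : prodSubSq ((n : ℚ) ^ 2) m * n =
      ((n + m).choose (2 * m + 1) : ℕ) * (2 * m + 1).factorial := by
    apply mul_right_cancel₀ h4
    push_cast at h3
    linarith
  have h6 : ((m : ℚ) + 1) * lucasCoeff n (m + 1) = n * ((n + m).choose (2 * m + 1) : ℕ) := by
    exact_mod_cast h1
  have h7 : (m : ℚ) + 1 ≠ 0 := by positivity
  have h8 : ((2 * m + 1).factorial : ℚ) ≠ 0 := by positivity
  have h9 : (2 * (m : ℚ) + 1 + 1) ≠ 0 := by positivity
  rw [show 2 * m + 2 = 2 * m + 1 + 1 by omega, Nat.factorial_succ]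
  push_cast
  rw [show 2 * (n : ℚ) ^ 2 * (prodSubSq ((n : ℚ) ^ 2) m / ((2 * m + 1 + 1) * (2 * m + 1).factorial))
    = 2 * n * (prodSubSq ((n : ℚ) ^ 2) m * n) / ((2 * m + 1 + 1) * (2 * m + 1).factorial) by ring,
    h5, eq_div_iff (by positivity)]
  linear_combination 2 * ((2 * m + 1).factorial : ℚ) * h6

/-! ### Power sums and Bernoulli numbers -/

namespace primePowMultiples

theorem not_dvd_succ_of_mem_range {p i : ℕ} (hi : i ∈ Finset.range (p - 1)) : ¬ p ∣ i + 1 := by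
  intro h
  have := Nat.le_of_dvd (Nat.succ_pos i) h
  rw [Finset.mem_range] at hi
  omega

theorem prime_sub_succ_eq {p i : ℕ} (hi : i ∈ Finset.range (p - 1)) :
    (((p - 1 - 1 - i : ℕ) : ℚ) + 1) = p - ((i : ℚ) + 1) := by
  rw [Finset.mem_range] at hi
  rw [Nat.sub_sub, Nat.sub_sub, Nat.cast_sub (by omega)]
  push_cast
  ring

theorem reflect_mem_range {p i : ℕ} (hi : i ∈ Finset.range (p - 1)) :
    p - 1 - 1 - i ∈ Finset.range (p - 1) := by
  rw [Finset.mem_range] at *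
  omega

theorem prime_sub_succ_ne_zero {p i : ℕ} (hi : i ∈ Finset.range (p - 1)) :
    (p : ℚ) - ((i : ℚ) + 1) ≠ 0 := by
  rw [← prime_sub_succ_eq hi]
  positivity

/-- Modulo 2n + 1, doubling permutes the residues: the values 2k ≤ 2n cancel against the even
arguments, and the others are an odd residue plus 2n + 1. -/
theorem sum_range_two_mul_sub (n : ℕ) (f : ℕ → ℚ) :
    ∑ k ∈ Finset.range (2 * n + 1), (f (2 * k) - f k) =
      ∑ k ∈ Finset.range n, (f (2 * k + 1 + (2 * n + 1)) - f (2 * k + 1)) := by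
  have h1 : ∀ n, ∑ k ∈ Finset.range (2 * n + 1), f k =
      ∑ k ∈ Finset.range (n + 1), f (2 * k) + ∑ k ∈ Finset.range n, f (2 * k + 1) := by
    intro n
    induction n with
    | zero => simp
    | succ n ih =>
      rw [show 2 * (n + 1) + 1 = 2 * n + 1 + 1 + 1 by ring, Finset.sum_range_succ,
        Finset.sum_range_succ, ih, Finset.sum_range_succ _ (n + 1),
        Finset.sum_range_succ (fun k => f (2 * k + 1)) n, show 2 * (n + 1) = 2 * n + 1 + 1 by ring]
      ring
  rw [Finset.sum_sub_distrib, Finset.sum_sub_distrib, h1, show 2 * n + 1 = (n + 1) + n by ring,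
    Finset.sum_range_add]
  have h2 : ∑ k ∈ Finset.range n, f (2 * (n + 1 + k)) =
      ∑ k ∈ Finset.range n, f (2 * k + 1 + (n + 1 + n)) :=
    Finset.sum_congr rfl fun k _ => by congr 1; ring
  rw [h2]
  ring

theorem two_mul_sum_range_inv_pow (p e : ℕ) :
    2 * ∑ i ∈ Finset.range (p - 1), (((i : ℚ) + 1) ^ e)⁻¹ =
      ∑ i ∈ Finset.range (p - 1), ((((i : ℚ) + 1) ^ e)⁻¹ + (((p : ℚ) - ((i : ℚ) + 1)) ^ e)⁻¹) := by
  rw [Finset.sum_add_distrib, two_mul]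
  congr 1
  rw [← Finset.sum_range_reflect]
  exact Finset.sum_congr rfl fun i hi => by rw [prime_sub_succ_eq hi]

theorem sq_sub_sq_ne_zero {p i : ℕ} (hi : i ∈ Finset.range (p - 1)) :
    ((i : ℚ) + 1) ^ 2 - (p : ℚ) ^ 2 ≠ 0 := by
  have hc0 : (p : ℚ) + ((i : ℚ) + 1) ≠ 0 := by positivity
  rw [show ((i : ℚ) + 1) ^ 2 - (p : ℚ) ^ 2 =
    -(((p : ℚ) - ((i : ℚ) + 1)) * ((p : ℚ) + ((i : ℚ) + 1))) by ring]
  exact neg_ne_zero.2 (mul_ne_zero (prime_sub_succ_ne_zero hi) hc0)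

variable {p : ℕ} [Fact p.Prime] {m : ℕ} {x y : ℚ}

theorem succ_mem (i : ℕ) : (i : ℚ) + 1 ∈ primePowMultiples p 0 :=
  add_mem (natCast_mem i) one_mem

theorem inv_succ_mem {i : ℕ} (hi : i ∈ Finset.range (p - 1)) :
    ((i : ℚ) + 1)⁻¹ ∈ primePowMultiples p 0 := by
  exact_mod_cast inv_natCast_mem (not_dvd_succ_of_mem_range hi)

theorem inv_prime_sub_succ_mem {i : ℕ} (hi : i ∈ Finset.range (p - 1)) :
    ((p : ℚ) - ((i : ℚ) + 1))⁻¹ ∈ primePowMultiples p 0 := by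
  rw [← prime_sub_succ_eq hi]
  exact inv_succ_mem (reflect_mem_range hi)

theorem inv_two_mem (h : p ≠ 2) : (2 : ℚ)⁻¹ ∈ primePowMultiples p 0 := by
  exact_mod_cast inv_natCast_mem (k := 2) fun h2 =>
    h ((Nat.prime_dvd_prime_iff_eq Fact.out Nat.prime_two).1 h2)

theorem of_mul_mem (hy : y⁻¹ ∈ primePowMultiples p 0) (hy0 : y ≠ 0)
    (h : y * x ∈ primePowMultiples p m) : x ∈ primePowMultiples p m := by
  have := zero_mul_mem hy h
  rwa [inv_mul_cancel_left₀ hy0] at this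

theorem inv_sq_sub_sq_mem {i : ℕ} (hi : i ∈ Finset.range (p - 1)) :
    (((i : ℚ) + 1) ^ 2 - (p : ℚ) ^ 2)⁻¹ ∈ primePowMultiples p 0 := by
  have hb' := inv_prime_sub_succ_mem hi
  have hc' : ((p : ℚ) + ((i : ℚ) + 1))⁻¹ ∈ primePowMultiples p 0 := by
    have := inv_natCast_mem (p := p) (k := p + (i + 1)) fun h =>
      not_dvd_succ_of_mem_range hi ((Nat.dvd_add_right dvd_rfl).1 h)
    exact_mod_cast this
  have := neg_mem (mul_zero_mem hb' hc')
  rwa [← mul_inv, ← inv_neg, show -(((p : ℚ) - ((i : ℚ) + 1)) * ((p : ℚ) + ((i : ℚ) + 1))) =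
    ((i : ℚ) + 1) ^ 2 - (p : ℚ) ^ 2 by ring] at this

/-- In each pair k, p - k the numerator is x⁵ + y⁵ with x + y = p. -/
theorem sum_range_inv_pow_five_mem (h2 : p ≠ 2) :
    ∑ i ∈ Finset.range (p - 1), (((i : ℚ) + 1) ^ 5)⁻¹ ∈ primePowMultiples p 1 := by
  refine of_mul_mem (y := 2) (inv_two_mem h2) two_ne_zero ?_
  rw [two_mul_sum_range_inv_pow]
  refine sum_mem fun i hi => ?_
  have ha := succ_mem (p := p) i
  have ha' := inv_succ_mem hi
  have hb' := inv_prime_sub_succ_mem hi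
  have hb : (p : ℚ) - ((i : ℚ) + 1) ∈ primePowMultiples p 0 := sub_mem (natCast_mem p) ha
  have ha0 : (i : ℚ) + 1 ≠ 0 := by positivity
  have hb0 := prime_sub_succ_ne_zero hi
  have e : (((i : ℚ) + 1) ^ 5)⁻¹ + (((p : ℚ) - ((i : ℚ) + 1)) ^ 5)⁻¹ =
      p * ((((i : ℚ) + 1)⁻¹ ^ 5 * ((p : ℚ) - ((i : ℚ) + 1))⁻¹ ^ 5) *
        (((i : ℚ) + 1) ^ 4 - ((i : ℚ) + 1) ^ 3 * ((p : ℚ) - ((i : ℚ) + 1)) +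
          ((i : ℚ) + 1) ^ 2 * ((p : ℚ) - ((i : ℚ) + 1)) ^ 2 -
          ((i : ℚ) + 1) * ((p : ℚ) - ((i : ℚ) + 1)) ^ 3 + ((p : ℚ) - ((i : ℚ) + 1)) ^ 4)) := by
    field_simp
    ring
  rw [e]
  exact mul_zero_mem prime_mem (mul_zero_mem (mul_zero_mem (pow_mem ha' 5) (pow_mem hb' 5))
    (add_mem (sub_mem (add_mem (sub_mem (pow_mem ha 4) (mul_zero_mem (pow_mem ha 3) hb))
      (mul_zero_mem (pow_mem ha 2) (pow_mem hb 2))) (mul_zero_mem ha (pow_mem hb 3)))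
        (pow_mem hb 4)))

/-- Expansion of (p - k)⁻³ = -(k⁻³ + 3p k⁻⁴ + 6p² k⁻⁵ + ...) up to p³, summed over the pairs k, p -
k. -/
theorem two_mul_sum_range_inv_pow_three_add_mem :
    2 * ∑ i ∈ Finset.range (p - 1), (((i : ℚ) + 1) ^ 3)⁻¹ +
      3 * p * ∑ i ∈ Finset.range (p - 1), (((i : ℚ) + 1) ^ 4)⁻¹ +
      6 * (p : ℚ) ^ 2 * ∑ i ∈ Finset.range (p - 1), (((i : ℚ) + 1) ^ 5)⁻¹ ∈
        primePowMultiples p 3 := by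
  rw [two_mul_sum_range_inv_pow, Finset.mul_sum, Finset.mul_sum, ← Finset.sum_add_distrib,
    ← Finset.sum_add_distrib]
  refine sum_mem fun i hi => ?_
  have ha := succ_mem (p := p) i
  have ha' := inv_succ_mem hi
  have hb' := inv_prime_sub_succ_mem hi
  have ha0 : (i : ℚ) + 1 ≠ 0 := by positivity
  have hb0 := prime_sub_succ_ne_zero hi
  have e : (((i : ℚ) + 1) ^ 3)⁻¹ + (((p : ℚ) - ((i : ℚ) + 1)) ^ 3)⁻¹ +
      3 * p * (((i : ℚ) + 1) ^ 4)⁻¹ + 6 * (p : ℚ) ^ 2 * (((i : ℚ) + 1) ^ 5)⁻¹ =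
      (p : ℚ) ^ 3 * ((((i : ℚ) + 1)⁻¹ ^ 5 * ((p : ℚ) - ((i : ℚ) + 1))⁻¹ ^ 3) *
        ((10 : ℕ) * ((i : ℚ) + 1) ^ 2 - (15 : ℕ) * p * ((i : ℚ) + 1) + (6 : ℕ) * (p : ℚ) ^ 2)) := by
    push_cast
    field_simp
    ring
  rw [e]
  exact mul_zero_mem (prime_pow_mem 3) (mul_zero_mem (mul_zero_mem (pow_mem ha' 5) (pow_mem hb' 3))
    (add_mem (sub_mem (mul_zero_mem (natCast_mem 10) (pow_mem ha 2))
      (mul_zero_mem (mul_zero_mem (natCast_mem 15) (natCast_mem p)) ha))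
        (mul_zero_mem (natCast_mem 6) (pow_mem (natCast_mem p) 2))))

/-- The recurrence for B_j divides only by j + 1, which is smaller than p. -/
theorem bernoulli_mem (j : ℕ) (hj : j + 1 < p) : bernoulli j ∈ primePowMultiples p 0 := by
  induction j using Nat.strong_induction_on with
  | _ j ih =>
    rcases Nat.eq_zero_or_pos j with rfl | hj0
    · simpa using one_mem
    have h := sum_bernoulli (j + 1)
    rw [if_neg (by omega), Finset.sum_range_succ] at h
    have hne : ((j : ℚ) + 1) ≠ 0 := by positivity
    refine of_mul_mem (y := (j : ℚ) + 1) (inv_succ_mem (Finset.mem_range.2 (by omega))) hne ?_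
    have e : ((j : ℚ) + 1) * bernoulli j =
        -∑ k ∈ Finset.range j, ((j + 1).choose k : ℚ) * bernoulli k := by
      rw [Nat.choose_succ_self_right] at h
      push_cast at h
      linarith
    rw [e]
    exact neg_mem (sum_mem fun k hk => mul_zero_mem (natCast_mem _)
      (ih k (Finset.mem_range.1 hk) (by rw [Finset.mem_range] at hk; omega)))

/-- In Faulhaber's formula the top Bernoulli number contributes p B_m; every other term carries at
least p², with denominators prime to p. -/
theorem sum_range_pow_sub_mem (m : ℕ) (hmp : m + 1 < p) :
    ∑ k ∈ Finset.range p, (k : ℚ) ^ m - p * bernoulli m ∈ primePowMultiples p 2 := by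
  rw [sum_range_pow, Finset.sum_range_succ]
  have e : bernoulli m * ((m + 1).choose m : ℚ) * (p : ℚ) ^ (m + 1 - m) / ((m : ℚ) + 1) =
      p * bernoulli m := by
    have hne : ((m : ℚ) + 1) ≠ 0 := by positivity
    rw [Nat.choose_succ_self_right, Nat.add_sub_cancel_left]
    push_cast
    field_simp
  rw [e, add_sub_cancel_right]
  refine sum_mem fun i hi => ?_
  rw [Finset.mem_range] at hi
  rw [div_eq_mul_inv]
  refine mul_zero_mem (zero_mul_mem (mul_zero_mem (bernoulli_mem i (by omega)) (natCast_mem _))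
    (anti (by omega) (prime_pow_mem (m + 1 - i)))) (inv_succ_mem (Finset.mem_range.2 (by omega)))

/-- Fermat alone relates k⁻⁴ to k^(p-5) only mod p. The extra power of p comes from applying the
doubling identity to both functions: mod p², (1/16 - 1)H ≡ -4pT and (2^(p-5) - 1)S ≡ -5pT with the
same sum T over odd numbers. Eliminating T gives 5H ≡ 4S ≡ 4pB_{p-5}. -/
theorem five_mul_sum_inv_pow_four_sub_mem (h5 : 5 < p) :
    5 * ∑ i ∈ Finset.range (p - 1), (((i : ℚ) + 1) ^ 4)⁻¹ - 4 * (p * bernoulli (p - 5)) ∈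
      primePowMultiples p 2 := by
  have hp : p.Prime := Fact.out
  obtain ⟨n, hn⟩ := hp.odd_of_ne_two (by omega)
  obtain ⟨m, hpm⟩ : ∃ m, p = m + 6 := ⟨p - 6, by omega⟩
  have hm : p - 5 = m + 1 := by omega
  rw [hm]
  have hodd : ∀ k ∈ Finset.range n, ¬ p ∣ 2 * k + 1 := by
    intro k hk h
    have := Nat.le_of_dvd (Nat.succ_pos _) h
    rw [Finset.mem_range] at hk
    omega
  have hodd' : ∀ k ∈ Finset.range n, ¬ p ∣ 2 * k + 1 + p := fun k hk h =>
    hodd k hk ((Nat.dvd_add_left dvd_rfl).1 h)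
  have hfermat : ∀ a : ℕ, ¬ p ∣ a → (a : ℚ) ^ (p - 1) - 1 ∈ primePowMultiples p 1 := by
    intro a ha
    have h := (Int.ModEq.pow_card_sub_one_eq_one hp (n := (a : ℤ))
      (Nat.isCoprime_iff_coprime.2 (((Nat.Prime.coprime_iff_not_dvd hp).2 ha).symm))).symm.dvd
    exact_mod_cast intCast_mem_one h
  have hfermat' : ∀ a : ℕ, ¬ p ∣ a → ∀ e, e ≤ p - 1 →
      (a : ℚ) ^ (p - 1 - e) - ((a : ℚ) ^ e)⁻¹ ∈ primePowMultiples p 1 := by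
    intro a ha e he
    have ha0 : (a : ℚ) ≠ 0 := by rintro h; exact ha (by simp [Nat.cast_eq_zero.1 h])
    have : (a : ℚ) ^ (p - 1 - e) - ((a : ℚ) ^ e)⁻¹ =
        ((a : ℚ) ^ (p - 1) - 1) * ((a : ℚ)⁻¹) ^ e := by
      rw [pow_sub₀ _ ha0 he, inv_pow]; ring
    rw [this]
    exact mul_zero_mem (hfermat a ha) (pow_mem (inv_natCast_mem ha) e)
  have hB := sum_range_pow_sub_mem (p := p) (m + 1) (by omega)
  set S := ∑ k ∈ Finset.range p, (k : ℚ) ^ (m + 1) with hS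
  set H := ∑ i ∈ Finset.range (p - 1), (((i : ℚ) + 1) ^ 4)⁻¹ with hH
  set T := ∑ k ∈ Finset.range n, ((2 * (k : ℚ) + 1) ^ 5)⁻¹ with hT
  -- the effect of the substitution `k ↦ 2 * k` on the sum of `k ^ (-4)`
  have hH' : (1 / 16 - 1) * H + 4 * p * T ∈ primePowMultiples p 2 := by
    have h := sum_range_two_mul_sub n (fun k => ((k : ℚ) ^ 4)⁻¹)
    rw [← hn] at h
    have e1 : ∑ k ∈ Finset.range p, ((((2 * k : ℕ) : ℚ) ^ 4)⁻¹ - ((k : ℚ) ^ 4)⁻¹) =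
        (1 / 16 - 1) * H := by
      -- The term k = 0 vanishes because 0⁻¹ = 0.
      rw [show p = p - 1 + 1 by omega, Finset.sum_range_succ', hH, Finset.mul_sum]
      simp only [mul_zero, Nat.cast_zero, ne_eq, OfNat.ofNat_ne_zero,
        not_false_eq_true, zero_pow, inv_zero, sub_self, add_zero]
      refine Finset.sum_congr rfl fun k _ => ?_
      have : (k : ℚ) + 1 ≠ 0 := by positivity
      push_cast
      field_simp
      norm_num
    rw [← e1, h, hT, Finset.mul_sum, ← Finset.sum_add_distrib]
    refine sum_mem fun k hk => ?_
    have ha' := inv_natCast_mem (hodd k hk)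
    have hb' := inv_natCast_mem (hodd' k hk)
    have ha0 : ((2 * k + 1 : ℕ) : ℚ) ≠ 0 := by positivity
    have hb0 : ((2 * k + 1 + p : ℕ) : ℚ) ≠ 0 := by positivity
    have e2 : (((2 * k + 1 + p : ℕ) : ℚ) ^ 4)⁻¹ - (((2 * k + 1 : ℕ) : ℚ) ^ 4)⁻¹ +
        4 * p * ((2 * (k : ℚ) + 1) ^ 5)⁻¹ = (p : ℚ) ^ 2 *
        (((2 * k + 1 : ℕ) : ℚ)⁻¹ ^ 5 * ((2 * k + 1 + p : ℕ) : ℚ)⁻¹ ^ 4 *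
        (10 * (2 * k + 1) ^ 3 + 20 * p * (2 * k + 1) ^ 2 + 15 * p ^ 2 * (2 * k + 1) + 4 * p ^ 3
          : ℕ)) := by
      push_cast at ha0 hb0 ⊢
      field_simp
      ring
    rw [e2]
    exact mul_zero_mem (prime_pow_mem 2) (mul_zero_mem (mul_zero_mem (pow_mem ha' 5)
      (pow_mem hb' 4)) (natCast_mem _))
  -- the same for the sum of `k ^ (p - 5)`
  have hS' : (2 ^ (m + 1) - 1) * S + 5 * p * T ∈ primePowMultiples p 2 := by
    have h := sum_range_two_mul_sub n (fun k => (k : ℚ) ^ (m + 1))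
    rw [← hn] at h
    have e1 : ∑ k ∈ Finset.range p, (((2 * k : ℕ) : ℚ) ^ (m + 1) - (k : ℚ) ^ (m + 1)) =
        (2 ^ (m + 1) - 1) * S := by
      rw [hS, Finset.mul_sum]
      refine Finset.sum_congr rfl fun k _ => ?_
      push_cast
      rw [mul_pow]
      ring
    rw [← e1, h, hT, Finset.mul_sum, ← Finset.sum_add_distrib]
    refine sum_mem fun k hk => ?_
    have h1 : (((2 * k + 1 + p : ℕ) : ℚ)) ^ (m + 1) - ((2 * k + 1 : ℕ) : ℚ) ^ (m + 1) -
        (m + 1) * p * ((2 * k + 1 : ℕ) : ℚ) ^ m ∈ primePowMultiples p 2 := by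
      obtain ⟨c, hc⟩ := (Polynomial.powAddExpansion ((2 * k + 1 : ℕ) : ℤ) (p : ℤ) (m + 1))
      have : (((2 * k + 1 + p : ℕ) : ℚ)) ^ (m + 1) - ((2 * k + 1 : ℕ) : ℚ) ^ (m + 1) -
        (m + 1) * p * ((2 * k + 1 : ℕ) : ℚ) ^ m = (p : ℚ) ^ 2 * (c : ℚ) := by
        have hc' := congrArg (Int.cast : ℤ → ℚ) hc
        push_cast at hc' ⊢
        linear_combination hc'
      rw [this]
      exact mul_zero_mem (prime_pow_mem 2) (intCast_mem c)
    have h2 := hfermat' _ (hodd k hk) 5 (by omega)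
    rw [show p - 1 - 5 = m by omega] at h2
    -- Here m = p - 6: the derivative coefficient m + 1 is -5 mod p, and a^m ≡ a⁻⁵ for odd a < p.
    have h3 : (p : ℚ) * ((p * ((2 * k + 1 : ℕ) : ℚ) ^ m) -
        ((5 : ℕ) : ℚ) * (((2 * k + 1 : ℕ) : ℚ) ^ m - (((2 * k + 1 : ℕ) : ℚ) ^ 5)⁻¹)) ∈
        primePowMultiples p 2 :=
      mul_mem (m := 1) (n := 1) prime_mem (sub_mem
        (mul_zero_mem prime_mem (pow_mem (natCast_mem _) m)) (zero_mul_mem (natCast_mem 5) h2))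
    have h4 := add_mem h1 h3
    convert h4 using 1
    rw [show (p : ℚ) = m + 6 by rw [hpm]; push_cast; ring]
    push_cast
    ring
  -- As S is divisible by p, replacing 2^(p-5) by 1/16 changes its multiple only by an element of
  -- p².
  have h16 := hfermat' 2 (fun h => by have := Nat.le_of_dvd two_pos h; omega) 4 (by omega)
  rw [show p - 1 - 4 = m + 1 by omega] at h16
  have hS1 : S ∈ primePowMultiples p 1 := by
    have h := add_mem (anti (n := 1) (by omega) hB)
      (mul_zero_mem prime_mem (bernoulli_mem (m + 1) (by omega)))
    rwa [sub_add_cancel] at h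
  have h1 := mul_mem h16 hS1
  have h15 : ((15 : ℕ) : ℚ)⁻¹ ∈ primePowMultiples p 0 := by
    refine inv_natCast_mem fun h => ?_
    rcases hp.dvd_mul.1 (show p ∣ 3 * 5 from h) with h | h <;>
      have := Nat.le_of_dvd (by norm_num) h <;> omega
  have h2 := mul_zero_mem (sub_mem (mul_zero_mem (mul_zero_mem hS' (natCast_mem 4)) (natCast_mem 16))
    (add_mem (mul_zero_mem (mul_zero_mem hH' (natCast_mem 5)) (natCast_mem 16))
      (mul_zero_mem (mul_zero_mem h1 (natCast_mem 4)) (natCast_mem 16)))) h15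
  have h3 := add_mem h2 (mul_zero_mem hB (natCast_mem 4))
  convert h3 using 1
  push_cast
  ring

/-- With H_e = ∑ k^(-e): V ≡ H₃ + p²H₅, 2H₃ ≡ -3pH₄ - 6p²H₅, p²H₅ ≡ 0 mod p³, and 5pH₄ ≡ 4p²B_{p-5}.
-/
theorem sum_inv_mul_sq_sub_sq_mem (h5 : 5 < p) :
    5 * ∑ n ∈ Finset.range (p - 1), 1 / (((n : ℚ) + 1) * (((n : ℚ) + 1) ^ 2 - (p : ℚ) ^ 2)) +
      6 * (p : ℚ) ^ 2 * bernoulli (p - 5) ∈ primePowMultiples p 3 := by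
  have h1 := two_mul_sum_range_inv_pow_three_add_mem (p := p)
  have h2 := mul_mem (prime_pow_mem 2) (sum_range_inv_pow_five_mem (p := p) (by omega))
  have h3 := mul_mem prime_mem (five_mul_sum_inv_pow_four_sub_mem h5)
  have h4 : ∑ n ∈ Finset.range (p - 1), 1 / (((n : ℚ) + 1) * (((n : ℚ) + 1) ^ 2 - (p : ℚ) ^ 2)) -
      (∑ i ∈ Finset.range (p - 1), (((i : ℚ) + 1) ^ 3)⁻¹ +
        (p : ℚ) ^ 2 * ∑ i ∈ Finset.range (p - 1), (((i : ℚ) + 1) ^ 5)⁻¹) ∈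
      primePowMultiples p 3 := by
    rw [Finset.mul_sum, ← Finset.sum_add_distrib]
    refine sum_sub_sum_mem fun i hi => ?_
    have ha' := inv_succ_mem hi
    have hd' := inv_sq_sub_sq_mem hi
    have ha0 : (i : ℚ) + 1 ≠ 0 := by positivity
    have hd0 := sq_sub_sq_ne_zero hi
    have e : 1 / (((i : ℚ) + 1) * (((i : ℚ) + 1) ^ 2 - (p : ℚ) ^ 2)) -
        ((((i : ℚ) + 1) ^ 3)⁻¹ + (p : ℚ) ^ 2 * (((i : ℚ) + 1) ^ 5)⁻¹) =
        (p : ℚ) ^ 4 * (((i : ℚ) + 1)⁻¹ ^ 5 * (((i : ℚ) + 1) ^ 2 - (p : ℚ) ^ 2)⁻¹) := by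
      field_simp
      ring
    rw [e]
    exact anti (by omega) (mul_zero_mem (prime_pow_mem 4)
      (mul_zero_mem (pow_mem ha' 5) hd'))
  refine of_mul_mem (y := 2) (inv_two_mem (by omega)) two_ne_zero ?_
  have h5 := add_mem (sub_mem (mul_zero_mem h4 (natCast_mem 10))
    (mul_zero_mem h2 (natCast_mem 20))) (sub_mem (mul_zero_mem h1 (natCast_mem 5))
      (mul_zero_mem h3 (natCast_mem 3)))
  convert h5 using 1
  push_cast
  ring

end primePowMultiples

/-! ### Lucas numbers and the finite logarithm -/

theorem coe_lucasNumber_eq (n : ℕ) :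
    (lucasNumber n : ℝ) = Real.goldenRatio ^ n + Real.goldenConj ^ n := by
  induction n using Nat.twoStepInduction with
  | zero => simp [lucasNumber]; norm_num
  | one => simp [lucasNumber]
  | more n ih1 ih2 =>
    rw [lucasNumber_add_two, Int.cast_add, ih1, ih2, pow_add _ n 2, pow_add _ n 2,
      Real.goldenRatio_sq, Real.goldenConj_sq]
    ring

theorem lucasNumber_two_mul_of_odd {n : ℕ} (hn : Odd n) :
    lucasNumber (2 * n) = lucasNumber n ^ 2 + 2 := by
  have h : (Real.goldenRatio * Real.goldenConj) ^ n = -1 := by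
    rw [Real.goldenRatio_mul_goldenConj, hn.neg_one_pow]
  rw [mul_pow] at h
  have : (lucasNumber (2 * n) : ℝ) = (lucasNumber n : ℝ) ^ 2 + 2 := by
    rw [coe_lucasNumber_eq, coe_lucasNumber_eq, mul_comm 2 n, pow_mul, pow_mul]
    linear_combination -2 * h
  exact_mod_cast this

theorem sum_Icc_one_eq_sum_range {M : Type*} [AddCommMonoid M] (f : ℕ → M) (N : ℕ) :
    ∑ k ∈ Finset.Icc 1 N, f k = ∑ m ∈ Finset.range N, f (m + 1) := by
  induction N with
  | zero => simp
  | succ N ih => rw [Finset.sum_Icc_succ_top (by omega), Finset.sum_range_succ, ih]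

theorem finiteLog_goldenRatio_sq_add (p : ℕ) :
    finiteLog p (Real.goldenRatio ^ (2 : ℤ)) + finiteLog p (Real.goldenRatio ^ (-2 : ℤ)) =
      ((∑ m ∈ Finset.range (p - 1), (lucasNumber (2 * (m + 1)) : ℚ) / ((m : ℚ) + 1) : ℚ) : ℝ) := by
  simp only [finiteLog]
  rw [← Finset.sum_add_distrib, sum_Icc_one_eq_sum_range]
  push_cast
  refine Finset.sum_congr rfl fun m _ => ?_
  rw [coe_lucasNumber_eq, zpow_neg, ← inv_zpow, Real.inv_goldenRatio, ← add_div, pow_mul, pow_mul]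
  norm_cast
  rw [neg_sq]

theorem two_mul_sq_mul_sum_prodSubSq (p : ℕ) (hp : Odd p) :
    2 * (p : ℚ) ^ 2 * ∑ m ∈ Finset.range (p - 1), prodSubSq ((p : ℚ) ^ 2) m /
        (((m : ℚ) + 1) * (2 * m + 2).factorial) =
      ((lucasNumber p : ℚ) ^ 2 - 1) / p +
        2 * (∑ m ∈ Finset.range (p - 1), (lucasNumber (2 * (m + 1)) : ℚ) / ((m : ℚ) + 1) -
          2 * harmonic (p - 1)) := by
  have h := sum_lucasCoeff_succ_div p p le_rfl
  have hp1 : p = p - 1 + 1 := by have := hp.pos; omega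
  have h1 : ∑ k ∈ Finset.range p, (lucasCoeff p (k + 1) : ℚ) / ((k : ℚ) + 1) =
      2 * (p : ℚ) ^ 2 * ∑ m ∈ Finset.range (p - 1), prodSubSq ((p : ℚ) ^ 2) m /
        (((m : ℚ) + 1) * (2 * m + 2).factorial) + 1 / p := by
    have e : Finset.range p = Finset.range (p - 1 + 1) := by rw [← hp1]
    rw [e, Finset.sum_range_succ, ← hp1, lucasCoeff_self hp.pos, Finset.mul_sum]
    congr 1
    · refine Finset.sum_congr rfl fun m hm => ?_
      rw [lucasCoeff_succ_eq p m (by rw [Finset.mem_range] at hm; omega)]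
      have h3 : (m : ℚ) + 1 ≠ 0 := by positivity
      field_simp
    · rw [Nat.cast_sub hp.pos]
      simp
  have h2 : ∑ j ∈ Finset.range p, ((lucasNumber (2 * j) : ℚ) - 2) / j =
      ∑ m ∈ Finset.range (p - 1), (lucasNumber (2 * (m + 1)) : ℚ) / ((m : ℚ) + 1) -
          2 * harmonic (p - 1) := by
    have e : Finset.range p = Finset.range (p - 1 + 1) := by rw [← hp1]
    rw [e, Finset.sum_range_succ', harmonic_eq_sum_range, Finset.mul_sum,
      ← Finset.sum_sub_distrib]
    simp only [Nat.cast_zero, div_zero, add_zero]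
    refine Finset.sum_congr rfl fun m _ => ?_
    push_cast
    ring
  rw [h1, h2, lucasNumber_two_mul_of_odd hp] at h
  push_cast at h
  linear_combination h

/-! ### Central binomial coefficients -/

namespace primePowMultiples

variable {p : ℕ} [Fact p.Prime]

/-- For k < p the prime p divides the central binomial coefficient at most once, because 2k < p². -/
theorem prime_mul_inv_centralBinom_mem {k : ℕ} (hk : k < p) :
    (p : ℚ) * (k.centralBinom : ℚ)⁻¹ ∈ primePowMultiples p 0 := by
  have hp : p.Prime := Fact.out
  have hp2 := hp.two_le
  by_cases h : p ∣ k.centralBinom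
  · obtain ⟨c, hc⟩ := h
    have hc' : ¬ p ∣ c := by
      rintro ⟨d, rfl⟩
      have h3 : p ^ 2 ∣ k.centralBinom := ⟨d, by rw [hc]; ring⟩
      have h4 := (hp.pow_dvd_iff_le_factorization k.centralBinom_ne_zero).1 h3
      have h5 : (Nat.choose (2 * k) k).factorization p ≤ 1 :=
        Nat.factorization_choose_le_one (by nlinarith)
      rw [← Nat.centralBinom_eq_two_mul_choose] at h5
      omega
    rw [hc, Nat.cast_mul, mul_inv, mul_inv_cancel_left₀ prime_ne_zero]
    exact inv_natCast_mem hc'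
  · exact zero_mul_mem (natCast_mem p) (inv_natCast_mem h)

theorem prod_sq_div_sq_sub_one_sub_mem (m : ℕ) (hm : m < p) :
    ∏ j ∈ Finset.range m, ((p : ℚ) ^ 2 * (((j : ℚ) + 1)⁻¹) ^ 2 - 1) - (-1) ^ m ∈
      primePowMultiples p 2 := by
  induction m with
  | zero => simp
  | succ m ih =>
    have hi := inv_succ_mem (p := p) (i := m) (Finset.mem_range.2 (by omega))
    have h1 := mul_zero_mem (prime_pow_mem 2) (pow_mem hi 2)
    have h2 := ih (by omega)
    rw [Finset.prod_range_succ]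
    have h3 := add_mem (mul_zero_mem h2 (sub_mem (anti (n := 0) (by omega) h1) one_mem))
      (zero_mul_mem (intCast_mem ((-1) ^ m)) h1)
    convert h3 using 1
    push_cast
    ring

theorem prodSubSq_div_factorial (p m : ℕ) :
    prodSubSq ((p : ℚ) ^ 2) m / (2 * m + 2).factorial =
      (∏ j ∈ Finset.range m, ((p : ℚ) ^ 2 * (((j : ℚ) + 1)⁻¹) ^ 2 - 1)) *
        ((m : ℚ) + 1)⁻¹ ^ 2 * ((m + 1).centralBinom : ℚ)⁻¹ := by
  have h1 : prodSubSq ((p : ℚ) ^ 2) m =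
      (∏ j ∈ Finset.range m, ((p : ℚ) ^ 2 * (((j : ℚ) + 1)⁻¹) ^ 2 - 1)) * (m.factorial : ℚ) ^ 2 := by
    induction m with
    | zero => simp [prodSubSq]
    | succ m ih =>
      rw [prodSubSq_succ, ih, Finset.prod_range_succ, Nat.factorial_succ]
      have h3 : (m : ℚ) + 1 ≠ 0 := by positivity
      push_cast
      field_simp
  have h2 : (((m + 1).centralBinom : ℕ) : ℚ) * (m + 1).factorial * (m + 1).factorial =
      (2 * m + 2).factorial := by
    have := Nat.choose_mul_factorial_mul_factorial (show m + 1 ≤ 2 * (m + 1) by omega)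
    rw [show 2 * (m + 1) - (m + 1) = m + 1 by omega,
      ← Nat.centralBinom_eq_two_mul_choose] at this
    exact_mod_cast this
  have h3 : (m : ℚ) + 1 ≠ 0 := by positivity
  have h4 : ((m + 1).centralBinom : ℚ) ≠ 0 := Nat.cast_ne_zero.2 (Nat.centralBinom_ne_zero _)
  have h5 : (m.factorial : ℚ) ≠ 0 := by positivity
  rw [h1, ← h2, Nat.factorial_succ]
  push_cast
  field_simp

/-- By `prodSubSq_div_factorial` each summand is ∏(p²/j² - 1) ≡ (-1)^m mod p² times p over a central
binomial coefficient, a p-integral factor; 1/((m+1)² - p²) ≡ 1/(m+1)² mod p² as well. -/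
theorem prime_mul_sum_prodSubSq_sub_mem :
    (p : ℚ) * ∑ m ∈ Finset.range (p - 1), prodSubSq ((p : ℚ) ^ 2) m /
        (((m : ℚ) + 1) * (2 * m + 2).factorial * (((m : ℚ) + 1) ^ 2 - (p : ℚ) ^ 2)) -
      (p : ℚ) * ∑ m ∈ Finset.range (p - 1), (-1) ^ m / (((m : ℚ) + 1) ^ 5 * (m + 1).centralBinom) ∈
      primePowMultiples p 2 := by
  rw [Finset.mul_sum, Finset.mul_sum]
  refine sum_sub_sum_mem fun m hm => ?_
  have hm' := Finset.mem_range.1 hm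
  have ha := inv_succ_mem hm
  have hr := prod_sq_div_sq_sub_one_sub_mem (p := p) m (by omega)
  have hC := prime_mul_inv_centralBinom_mem (p := p) (k := m + 1) (by omega)
  have hd := inv_sq_sub_sq_mem hm
  have hd0 := sq_sub_sq_ne_zero hm
  have h3 : (m : ℚ) + 1 ≠ 0 := by positivity
  have h4 : ((m + 1).centralBinom : ℚ) ≠ 0 := Nat.cast_ne_zero.2 (Nat.centralBinom_ne_zero _)
  have h5 := zero_mul_mem (mul_zero_mem hC (pow_mem ha 3)) (add_mem (mul_zero_mem hr hd)
    (zero_mul_mem (intCast_mem ((-1) ^ m)) (mul_zero_mem (prime_pow_mem 2)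
      (mul_zero_mem (pow_mem ha 2) hd))))
  convert h5 using 1
  rw [show ∀ q a f d : ℚ, (p : ℚ) * (q / (a * f * d)) = p * (q / f) / (a * d) by
    intros; simp only [div_eq_mul_inv, mul_inv]; ring, prodSubSq_div_factorial]
  push_cast
  field_simp
  ring

theorem centralBinom_prime_sub_two_mem :
    ((p.centralBinom : ℕ) : ℚ) - 2 ∈ primePowMultiples p 1 := by
  have hp : p.Prime := Fact.out
  have h := Choose.choose_modEq_choose_mod_mul_choose_div (n := 2 * p) (k := p) (p := p)
  rw [Nat.mul_mod_left, Nat.mod_self, Nat.mul_div_cancel _ hp.pos, Nat.div_self hp.pos,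
    ← Nat.centralBinom_eq_two_mul_choose] at h
  have := intCast_mem_one (p := p) h.symm.dvd
  simpa using this

/-- Both sides start at 1/2 mod p, and the recurrence of the central binomial coefficients
multiplies them by the same ratio mod p, since p - j - 1 ≡ -(j + 1). -/
theorem prime_div_centralBinom_sub_mem (h2 : p ≠ 2) (j : ℕ) (hj : j < p) :
    (p : ℚ) / (((p - j : ℕ) : ℚ) * (p - j).centralBinom) - j.centralBinom / 2 ∈
      primePowMultiples p 1 := by
  have hp : p.Prime := Fact.out
  induction j with
  | zero =>
    have h := centralBinom_prime_sub_two_mem (p := p)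
    have hnd : ¬ p ∣ p.centralBinom := by
      rintro ⟨c, hc⟩
      rw [hc, Nat.cast_mul] at h
      have h3 := sub_mem (mul_zero_mem prime_mem (natCast_mem c)) h
      rw [sub_sub_cancel] at h3
      have h4 := mul_zero_mem h3 (inv_two_mem h2)
      rw [mul_inv_cancel₀ two_ne_zero] at h4
      obtain ⟨r, hr, h5⟩ := h4
      rw [pow_one] at h5
      have h6 : (p : ℚ)⁻¹ ∈ primePowMultiples p 0 := by
        rw [inv_eq_of_mul_eq_one_right h5.symm]
        exact mem_zero_iff.2 hr
      rw [mem_zero_iff] at h6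
      rw [Rat.inv_natCast_den, if_neg hp.ne_zero] at h6
      exact h6 dvd_rfl
    have h3 := neg_mem (mul_zero_mem h (mul_zero_mem (inv_two_mem h2) (inv_natCast_mem hnd)))
    have h4 : (p.centralBinom : ℚ) ≠ 0 := Nat.cast_ne_zero.2 (Nat.centralBinom_ne_zero _)
    have h5 := prime_ne_zero (p := p)
    convert h3 using 1
    simp only [Nat.sub_zero, Nat.centralBinom_zero]
    push_cast
    field_simp
    ring
  | succ j ih =>
    have ih := ih (by omega)
    obtain ⟨k, hk⟩ := Nat.exists_eq_add_of_lt hj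
    have hpk : (p : ℚ) = j + 1 + k + 1 := by rw [hk]; push_cast; ring
    have e1 : p - j = k + 1 + 1 := by omega
    have e2 : p - (j + 1) = k + 1 := by omega
    rw [e1] at ih
    rw [e2]
    have c1 : ((k : ℚ) + 1 + 1) * (k + 1 + 1).centralBinom =
        2 * (2 * (k + 1) + 1) * (k + 1).centralBinom := by
      exact_mod_cast Nat.succ_mul_centralBinom_succ (k + 1)
    have c2 : ((j : ℚ) + 1) * (j + 1).centralBinom = 2 * (2 * j + 1) * j.centralBinom := by
      exact_mod_cast Nat.succ_mul_centralBinom_succ j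
    have hk1 := inv_succ_mem (p := p) (i := k) (Finset.mem_range.2 (by omega))
    have hj1 := inv_succ_mem (p := p) (i := j) (Finset.mem_range.2 (by omega))
    have h3 := add_mem (mul_zero_mem ih (mul_zero_mem (natCast_mem (2 * (2 * (k + 1) + 1))) hk1))
      (mul_zero_mem prime_mem (mul_zero_mem (natCast_mem j.centralBinom) (mul_zero_mem hk1 hj1)))
    have h4 : ((k + 1).centralBinom : ℚ) ≠ 0 := Nat.cast_ne_zero.2 (Nat.centralBinom_ne_zero _)
    have h6 : (k : ℚ) + 1 ≠ 0 := by positivity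
    have h7 : (j : ℚ) + 1 ≠ 0 := by positivity
    have h8 : 2 * ((k : ℚ) + 1) + 1 ≠ 0 := by positivity
    convert h3 using 1
    rw [eq_div_of_mul_eq h7 ((mul_comm _ _).trans c2)]
    push_cast
    rw [c1, hpk]
    field_simp
    ring

theorem two_mul_prime_mul_sum_sub_mem (h2 : p ≠ 2) :
    2 * ((p : ℚ) * ∑ m ∈ Finset.range (p - 1), (-1) ^ m / (((m : ℚ) + 1) ^ 5 * (m + 1).centralBinom)) -
      ∑ m ∈ Finset.range (p - 1), (-1) ^ (m + 1) * ((m + 1).centralBinom : ℚ) / ((m : ℚ) + 1) ^ 4 ∈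
      primePowMultiples p 1 := by
  have hp : p.Prime := Fact.out
  rw [← Finset.sum_range_reflect, ← mul_assoc, Finset.mul_sum]
  refine sum_sub_sum_mem fun m hm => ?_
  have hm' := Finset.mem_range.1 hm
  have ha := inv_succ_mem hm
  have hb := inv_prime_sub_succ_mem hm
  have h := prime_div_centralBinom_sub_mem h2 (m + 1) (by omega)
  rw [prime_sub_succ_eq hm, show p - 1 - 1 - m + 1 = p - (m + 1) by omega]
  have hs : (-1 : ℚ) ^ (p - 1 - 1 - m) = (-1) ^ (m + 1) := by
    obtain ⟨n, hn⟩ := hp.odd_of_ne_two h2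
    exact neg_one_pow_congr (by rw [Nat.even_iff, Nat.even_iff]; omega)
  rw [hs]
  rw [Nat.cast_sub (by omega)] at h
  push_cast at h
  have h3 := zero_mul_mem (intCast_mem ((-1) ^ (m + 1))) (add_mem
    (mul_zero_mem (mul_zero_mem h (pow_mem hb 4)) (natCast_mem 2))
    (mul_zero_mem prime_mem (mul_zero_mem (natCast_mem (m + 1).centralBinom)
      (mul_zero_mem (mul_zero_mem (pow_mem ha 4) (pow_mem hb 4))
        (mul_zero_mem (sub_mem (mul_zero_mem (natCast_mem 2) (succ_mem m)) (natCast_mem p))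
          (add_mem (pow_mem (succ_mem m) 2)
            (pow_mem (sub_mem (natCast_mem p) (succ_mem m)) 2)))))))
  have h4 : ((p - (m + 1)).centralBinom : ℚ) ≠ 0 :=
    Nat.cast_ne_zero.2 (Nat.centralBinom_ne_zero _)
  have h6 : (m : ℚ) + 1 ≠ 0 := by positivity
  have h7 := prime_sub_succ_ne_zero hm
  convert h3 using 1
  push_cast
  field_simp
  ring

end primePowMultiples

/-! ### Assembly of the two congruences -/

open primePowMultiples in
theorem theorem4 (p : ℕ) (hp : p.Prime) (hp5 : 5 < p) :
    CongrModPrimePow p 2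
      ((p : ℝ) * ∑ k ∈ Finset.Icc 1 (p - 1),
        (-1 : ℝ) ^ (k - 1) / ((k : ℝ) ^ 5 * (Nat.choose (2 * k) k : ℝ)))
      (5 * (1 - (lucasNumber p : ℝ) ^ 2) / (8 * (p : ℝ) ^ 4)
        - 5 / (4 * (p : ℝ) ^ 3)
          * (finiteLog p (Real.goldenRatio ^ (2 : ℤ)) + finiteLog p (Real.goldenRatio ^ (-2 : ℤ)))
        + 3 * ((harmonic (p - 1) : ℚ) : ℝ) / (p : ℝ) ^ 3
        - 3 * (p : ℝ) / 5 * ((bernoulli (p - 5) : ℚ) : ℝ)) ∧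
    CongrModPrimePow p 1
      (∑ k ∈ Finset.Icc 1 (p - 1),
        (-1 : ℝ) ^ k * (Nat.choose (2 * k) k : ℝ) / (k : ℝ) ^ 4)
      (5 * (1 - (lucasNumber p : ℝ) ^ 2) / (4 * (p : ℝ) ^ 4)
        - 5 / (2 * (p : ℝ) ^ 3)
          * (finiteLog p (Real.goldenRatio ^ (2 : ℤ)) + finiteLog p (Real.goldenRatio ^ (-2 : ℤ)))
        + 6 * ((harmonic (p - 1) : ℚ) : ℝ) / (p : ℝ) ^ 3) := by
  have : Fact p.Prime := ⟨hp⟩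
  have hp0 : (p : ℚ) ≠ 0 := prime_ne_zero
  have hT := two_mul_sq_mul_sum_prodSubSq p (hp.odd_of_ne_two (by omega))
  have hV := sum_one_div_mul_sq_sub_sq_eq p hp.pos
  have hB := sum_inv_mul_sq_sub_sq_mem hp5
  have hU := prime_mul_sum_prodSubSq_sub_mem (p := p)
  have hD := two_mul_prime_mul_sum_sub_mem (p := p) (by omega)
  have hbern := bernoulli_mem (p := p) (p - 5) (by omega)
  rw [finiteLog_goldenRatio_sq_add, sum_Icc_one_eq_sum_range, sum_Icc_one_eq_sum_range]
  generalize ∑ m ∈ Finset.range (p - 1), (lucasNumber (2 * (m + 1)) : ℚ) / ((m : ℚ) + 1) = l at *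
  have e1 : (p : ℝ) * ∑ m ∈ Finset.range (p - 1),
      (-1 : ℝ) ^ (m + 1 - 1) / (((m + 1 : ℕ) : ℝ) ^ 5 * (Nat.choose (2 * (m + 1)) (m + 1) : ℝ)) =
      (((p : ℚ) * ∑ m ∈ Finset.range (p - 1),
        (-1) ^ m / (((m : ℚ) + 1) ^ 5 * (m + 1).centralBinom) : ℚ) : ℝ) := by
    simp [Nat.centralBinom_eq_two_mul_choose]
  have e2 : ∑ m ∈ Finset.range (p - 1), (-1 : ℝ) ^ (m + 1) *
      (Nat.choose (2 * (m + 1)) (m + 1) : ℝ) / ((m + 1 : ℕ) : ℝ) ^ 4 =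
      ((∑ m ∈ Finset.range (p - 1),
        (-1) ^ (m + 1) * ((m + 1).centralBinom : ℚ) / ((m : ℚ) + 1) ^ 4 : ℚ) : ℝ) := by
    simp [Nat.centralBinom_eq_two_mul_choose]
  rw [e1, e2]
  generalize (p : ℚ) * ∑ m ∈ Finset.range (p - 1),
    (-1) ^ m / (((m : ℚ) + 1) ^ 5 * (m + 1).centralBinom) = S at *
  generalize ∑ m ∈ Finset.range (p - 1),
    (-1) ^ (m + 1) * ((m + 1).centralBinom : ℚ) / ((m : ℚ) + 1) ^ 4 = S' at *
  generalize ∑ m ∈ Finset.range (p - 1), prodSubSq ((p : ℚ) ^ 2) m /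
    (((m : ℚ) + 1) * (2 * m + 2).factorial * (((m : ℚ) + 1) ^ 2 - (p : ℚ) ^ 2)) = U at *
  generalize ∑ m ∈ Finset.range (p - 1), prodSubSq ((p : ℚ) ^ 2) m /
    (((m : ℚ) + 1) * (2 * m + 2).factorial) = T at *
  generalize ∑ n ∈ Finset.range (p - 1),
    1 / (((n : ℚ) + 1) * (((n : ℚ) + 1) ^ 2 - (p : ℚ) ^ 2)) = V at *
  have hT' : T = (((lucasNumber p : ℚ) ^ 2 - 1) / p + 2 * (l - 2 * harmonic (p - 1))) /
      (2 * (p : ℚ) ^ 2) := by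
    rw [eq_div_iff (by positivity), ← hT]; ring
  have h2 := inv_two_mem (p := p) (by omega)
  have h5 : (5 : ℚ)⁻¹ ∈ primePowMultiples p 0 := by
    exact_mod_cast inv_natCast_mem (p := p) (k := 5) fun h => by
      have := Nat.le_of_dvd (by norm_num) h; omega
  -- Solving the Koecher-Leshchiner relation for pU divides V by 2p, which is why V is needed mod
  -- p³.
  have hW : p * U - (5 * (1 - (lucasNumber p : ℚ) ^ 2) / (8 * (p : ℚ) ^ 4) -
      5 / (4 * (p : ℚ) ^ 3) * l + 3 * harmonic (p - 1) / (p : ℚ) ^ 3 -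
      3 * p / 5 * bernoulli (p - 5)) ∈ primePowMultiples p 2 := by
    refine of_prime_pow_mul_mem (n := 1) ?_
    have h := mul_zero_mem (mul_zero_mem hB h5) h2
    convert h using 1
    rw [hV, hT']
    field_simp
    ring
  have hX := sub_mem hW hU
  constructor
  · have h : S - (5 * (1 - (lucasNumber p : ℚ) ^ 2) / (8 * (p : ℚ) ^ 4) -
        5 / (4 * (p : ℚ) ^ 3) * l + 3 * harmonic (p - 1) / (p : ℚ) ^ 3 -
        3 * p / 5 * bernoulli (p - 5)) ∈ primePowMultiples p 2 := by
      convert hX using 1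
      ring
    have := congrModPrimePow_of_sub_mem h
    push_cast at this
    exact this
  · have h : S' - (5 * (1 - (lucasNumber p : ℚ) ^ 2) / (4 * (p : ℚ) ^ 4) -
        5 / (2 * (p : ℚ) ^ 3) * l + 6 * harmonic (p - 1) / (p : ℚ) ^ 3) ∈
        primePowMultiples p 1 := by
      -- Twice the first congruence, read mod p: the Bernoulli term (6p/5)B_{p-5} drops out.
      have := sub_mem (mul_zero_mem (anti (n := 1) (by omega) hX) (natCast_mem 2)) (add_mem hD
        (mul_zero_mem prime_mem (mul_zero_mem (mul_zero_mem (natCast_mem 6) h5) hbern)))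
      convert this using 1
      push_cast
      field_simp
      ring
    have := congrModPrimePow_of_sub_mem h
    push_cast at this
    exact this
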